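/- An action operad $\Lambda$ is an operad $\{\Lambda(n)\}_{n\ge 0}$ of sets, with composition $\mu^\Lambda$, in which every $\Lambda(n)$ is a group, together with group homomorphisms $\pi_n:\Lambda(n)\to\Sigma_n$ forming a map of operads to the operad of symmetric groups, such that $$\mu^\Lambda(g;f_1,\dots,f_n)\,\mu^\Lambda(g';f'_1,\dots,f'_n)=\mu^\Lambda\bigl(gg';f_{\pi(g')(1)}f'_1,\dots,f_{\pi(g')(n)}f'_n\bigr)$$ whenever $f'_i\in\Lambda(k_i)$ and $f_i\in\Lambda(k_{\pi(g')^{-1}(i)})$. A $\Lambda$-operad $P$ in a symmetric monoidal category is an operad $\{P(n)\}_{n\ge0}$ (objects, a unit $I\to P(1)$ and associative, unital composition maps $\mu^P:P(n)\otimes P(k_1)\otimes\cdots\otimes P(k_n)\to P(k_1+\cdots+k_n)$) with a right action of each group $\Lambda(n)$ on $P(n)$ such that the diagrams expressing the following two equations commute: $$\mu^P(x;y_1\cdot g_1,\dots,y_n\cdot g_n)=\mu^P(x;y_1,\dots,y_n)\cdot\mu^\Lambda(e;g_1,\dots,g_n),$$ $$\mu^P(x\cdot g;y_1,\dots,y_n)=\mu^P(x;y_{\pi(g)^{-1}(1)},\dots,y_{\pi(g)^{-1}(n)})\cdot\mu^\Lambda(g;e,\dots,e).$$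 A morphism of $\Lambda$-operads is a family of maps $P(n)\to Q(n)$ compatible with units, compositions and actions; $\Lambda\text{-}Op(M)$ denotes the category of $\Lambda$-operads in $M$. **Theorem.** Let $\Lambda$ be an action operad. 1. Let $M,N$ be cocomplete symmetric monoidal categories whose tensor products preserve colimits in each variable, and let $F:M\to N$ be a symmetric lax monoidal functor with constraints $\varphi_0:I_N\to FI_M$ and $\varphi_2:FX\otimes FY\to F(X\otimes Y)$. For every $\Lambda$-operad $P$ in $M$, the family $FP=\{F(P(n))\}$ is a $\Lambda$-operad in $N$ with unit $I_N\xrightarrow{\varphi_0}FI_M\to F(P(1))$, with composition $$F(P(n))\otimes F(P(k_1))\otimes\cdots\otimes F(P(k_n))\longrightarrow F\bigl(P(n)\otimes P(k_1)\otimes\cdots\otimes P(k_n)\bigr)\xrightarrow{F(\mu^P)}F(P(k_1+\cdots+k_n))$$ whose first map is the iterated constraint, and with $g\in\Lambda(n)$ acting on $F(P(n))$ by the image under $F$ of its action on $P(n)$. Together with $f=(f_n)\mapsto (F(f_n))$ on morphisms, this is a functor $\Lambda\text{-}Op(M)\to\Lambda\text{-}Op(N)$. 2. The operad $\Lambda$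 itself, with each $\Lambda(n)$ acting on itself by right multiplication, is a $\Lambda$-operad in the category of sets. 3. For a set $X$ let $EX$ be the category with object set $X$ and exactly one morphism between any two objects; regard $E$ as a symmetric lax monoidal functor from sets to $\mathbf{Cat}$ (cartesian monoidal structures), with constraints $*\mapsto *$ and $(x,y)\mapsto(x,y)$ on objects. Then $E\Lambda=\{E(\Lambda(n))\}$, with the structure induced from 2 by $E$ as in 1, is a $\Lambda$-operad in $\mathbf{Cat}$, and it is $\Lambda_\infty$: for each $n$ the action of $\Lambda(n)$ on $E(\Lambda(n))$ is free, and the category $E(\Lambda(n))$ is contractible (equivalent to the terminal category). -/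

import Mathlib

open CategoryTheory MonoidalCategory Limits

universe w v u v' u'

namespace LambdaOp

/-! ### Blocks

Throughout, operadic composition is written with a parameter `m` for the total arity and a proof
that `∑ i, k i = m`; since `m` is determined by `k`, this is only a device to avoid transports
along equalities of natural numbers. -/

/-- The position, among the `s = k 0 + ⋯ + k (n-1)` inputs, of the `j`-th input of the `i`-th block
(blocks are listed in order). -/
def blockIndex {n : ℕ} (k : Fin n → ℕ) {s : ℕ} (hk : ∑ i, k i = s) (i : Fin n) (j : Fin (k i)) :
    Fin s :=
  Fin.cast hk (finSigmaFinEquiv ⟨i, j⟩)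

theorem blockIndex_val {n : ℕ} (k : Fin n → ℕ) {s : ℕ} (hk : ∑ i, k i = s) (i : Fin n)
    (j : Fin (k i)) :
    (blockIndex k hk i j : ℕ) =
      ∑ l : Fin (i : ℕ), k (Fin.castLE i.2.le l) + (j : ℕ) := by
  simp [blockIndex, finSigmaFinEquiv_apply]

theorem sum_perm {n : ℕ} (σ : Equiv.Perm (Fin n)) (k : Fin n → ℕ) {m : ℕ} (h : ∑ i, k i = m) :
    ∑ i, k (σ.symm i) = m :=
  (Equiv.sum_comp σ.symm k).trans h

/-! ### Operads of sets and action operads -/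

/-- An operad in the category of sets (no symmetric group actions). -/
structure SetOperad where
  obj : ℕ → Type w
  one : obj 1
  comp : ∀ {n : ℕ} (k : Fin n → ℕ) {m : ℕ}, ∑ i, k i = m → obj n → (∀ i, obj (k i)) → obj m
  one_comp : ∀ {m : ℕ} (h : ∑ _i : Fin 1, m = m) (x : obj m),
    comp (fun _ : Fin 1 => m) h one (fun _ => x) = x
  comp_one : ∀ {n : ℕ} (h : ∑ _i : Fin n, 1 = n) (x : obj n),
    comp (fun _ : Fin n => 1) h x (fun _ => one) = x
  assoc : ∀ {n : ℕ} (k : Fin n → ℕ) {s : ℕ} (hk : ∑ i, k i = s) (l : Fin s → ℕ) {m : ℕ}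
    (hl : ∑ p, l p = m) (hl' : ∑ i, ∑ j, l (blockIndex k hk i j) = m)
    (x : obj n) (y : ∀ i, obj (k i)) (z : ∀ p, obj (l p)),
    comp (fun i => ∑ j, l (blockIndex k hk i j)) hl' x
        (fun i => comp (fun j => l (blockIndex k hk i j)) rfl (y i)
          (fun j => z (blockIndex k hk i j))) =
      comp l hl (comp k hk x y) z

/-- Composition in the operad of symmetric groups: the `i`-th of `n` blocks, of size `k i`, is
permuted internally by `τ i`, and the blocks are then permuted by `σ`. -/
def permComp {n : ℕ} (k : Fin n → ℕ) {m : ℕ} (h : ∑ i, k i = m) (σ : Equiv.Perm (Fin n))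
    (τ : ∀ i, Equiv.Perm (Fin (k i))) : Equiv.Perm (Fin m) :=
  (finSigmaFinEquiv.trans (finCongr h)).symm.trans
    (((Equiv.sigmaCongrRight τ).trans (Equiv.sigmaCongrLeft' σ)).trans
      (finSigmaFinEquiv.trans (finCongr (sum_perm σ k h))))

/-- `permComp` sends the `j`-th element of the `i`-th block to the `τ i j`-th element of the block
in position `σ i`. -/
theorem permComp_blockIndex {n : ℕ} (k : Fin n → ℕ) {m : ℕ} (h : ∑ i, k i = m)
    (σ : Equiv.Perm (Fin n)) (τ : ∀ i, Equiv.Perm (Fin (k i))) (i : Fin n) (j : Fin (k i)) :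
    permComp k h σ τ (blockIndex k h i j) =
      blockIndex (fun i => k (σ.symm i)) (sum_perm σ k h) (σ i)
        (Fin.cast (by simp) (τ i j)) := by
  have key : (Equiv.sigmaCongrLeft' σ) (⟨i, τ i j⟩ : Σ i, Fin (k i)) =
      (⟨σ i, Fin.cast (by simp) (τ i j)⟩ : Σ i, Fin (k (σ.symm i))) := by
    rw [Equiv.sigmaCongrLeft', Equiv.symm_apply_eq]
    simp only [Equiv.sigmaCongrLeft, Equiv.coe_fn_mk]
    refine Sigma.ext (by simp) ?_
    have : ∀ {a b : ℕ} (hab : a = b) (x : Fin a), HEq x (Fin.cast hab x) := by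
      rintro a _ rfl x; rfl
    exact this (by simp) _
  simp [permComp, blockIndex, key]

/-- An action operad: an operad of sets whose sets of operations are groups, with an operad map to
the symmetric groups which is levelwise a group homomorphism, satisfying one more axiom. -/
structure ActionOperad extends SetOperad.{w} where
  group : ∀ n, Group (obj n)
  π : ∀ n, obj n →* Equiv.Perm (Fin n)
  π_one : π 1 one = 1
  π_comp : ∀ {n : ℕ} (k : Fin n → ℕ) {m : ℕ} (h : ∑ i, k i = m) (g : obj n)
    (f : ∀ i, obj (k i)),
    π m (comp k h g f) = permComp k h (π n g) (fun i => π (k i) (f i))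
  /-- The axiom `μ(g; f₁, …, fₙ) μ(g'; f'₁, …, f'ₙ) = μ(gg'; f_{π(g')(1)} f'₁, …)`, written with
  `a i = f_{π(g')(i)}`, that is, `f i = a (π(g')⁻¹ i)`. -/
  comp_mul_comp : ∀ {n : ℕ} (k : Fin n → ℕ) {m : ℕ} (h : ∑ i, k i = m) (g g' : obj n)
    (a f' : ∀ i, obj (k i)),
    comp (fun i => k ((π n g').symm i)) (sum_perm (π n g') k h) g
        (fun i => a ((π n g').symm i)) * comp k h g' f' =
      comp k h (g * g') (fun i => a i * f' i)

instance (Λ : ActionOperad.{w}) (n : ℕ) : Group (Λ.obj n) := Λ.group n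

/-! ### Iterated tensor products -/

section Tensor

variable {C : Type u} [Category.{v} C] [MonoidalCategory C]

/-- `X 0 ⊗ (X 1 ⊗ (⋯ ⊗ 𝟙_ C))`. -/
def tensorFin : {n : ℕ} → (Fin n → C) → C
  | 0, _ => 𝟙_ C
  | _ + 1, X => X 0 ⊗ tensorFin (fun i => X i.succ)

/-- Functoriality of the iterated tensor product. -/
def tensorFinMap : {n : ℕ} → {X Y : Fin n → C} → (∀ i, X i ⟶ Y i) → (tensorFin X ⟶ tensorFin Y)
  | 0, _, _, _ => 𝟙 (𝟙_ C)
  | _ + 1, _, _, f => f 0 ⊗ₘ tensorFinMap (fun i => f i.succ)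

theorem tensorFinMap_id : ∀ {n : ℕ} (X : Fin n → C),
    tensorFinMap (fun i => 𝟙 (X i)) = 𝟙 (tensorFin X)
  | 0, _ => rfl
  | n + 1, X => by
      have := tensorFinMap_id (fun i : Fin n => X i.succ)
      simp only [tensorFinMap, this]
      exact MonoidalCategory.id_tensorHom_id _ _

theorem tensorFinMap_comp : ∀ {n : ℕ} {X Y Z : Fin n → C} (f : ∀ i, X i ⟶ Y i)
    (g : ∀ i, Y i ⟶ Z i),
    tensorFinMap (fun i => f i ≫ g i) = tensorFinMap f ≫ tensorFinMap g
  | 0, _, _, _, _, _ => (Category.comp_id (𝟙 (𝟙_ C))).symm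
  | n + 1, X, Y, Z, f, g => by
      have := tensorFinMap_comp (fun i : Fin n => f i.succ) (fun i => g i.succ)
      simp only [tensorFinMap, this]
      exact (MonoidalCategory.tensorHom_comp_tensorHom _ _ _ _).symm

/-- The identification of the iterated tensor products of two equal families. -/
def tensorEq {a b : ℕ} (h : a = b) {X : Fin a → C} {Y : Fin b → C}
    (hXY : ∀ i, X i = Y (Fin.cast h i)) : tensorFin X ⟶ tensorFin Y :=
  eqToHom (by subst h; exact congrArg tensorFin (funext hXY))

/-- The canonical isomorphism `𝟙 ⊗ (𝟙 ⊗ ⋯) ⟶ 𝟙`. -/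
def tensorUnits : (n : ℕ) → (tensorFin (fun _ : Fin n => 𝟙_ C) ⟶ 𝟙_ C)
  | 0 => 𝟙 (𝟙_ C)
  | n + 1 => (λ_ (tensorFin (fun _ : Fin n => 𝟙_ C))).hom ≫ tensorUnits n

/-- The canonical isomorphism
`(W 0 ⊗ ⋯ ⊗ W (a-1)) ⊗ (W a ⊗ ⋯ ⊗ W (a+b-1)) ⟶ W 0 ⊗ ⋯ ⊗ W (a+b-1)`. -/
def tensorAppend : (a : ℕ) → {b m : ℕ} → (h : a + b = m) → (W : Fin m → C) →
    (tensorFin (fun i : Fin a => W (Fin.cast h (Fin.castAdd b i))) ⊗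
      tensorFin (fun j : Fin b => W (Fin.cast h (Fin.natAdd a j))) ⟶ tensorFin W)
  | 0, b, m, h, W =>
      (λ_ (tensorFin (fun j : Fin b => W (Fin.cast h (Fin.natAdd 0 j))))).hom ≫
        tensorEq ((Nat.zero_add b).symm.trans h)
          (fun j => congrArg W (Fin.ext (by simp)))
  | a + 1, b, 0, h, W => absurd h (by omega)
  | a + 1, b, m + 1, h, W =>
      (α_ (W 0) (tensorFin (fun i : Fin a => W (Fin.cast h (Fin.castAdd b i.succ))))
          (tensorFin (fun j : Fin b => W (Fin.cast h (Fin.natAdd (a + 1) j))))).hom ≫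
        (W 0 ◁ (tensorFin (fun i : Fin a => W (Fin.cast h (Fin.castAdd b i.succ))) ◁
          tensorEq rfl (fun j => congrArg W (Fin.ext (Nat.succ_add_eq_add_succ a j))))) ≫
        (W 0 ◁ tensorAppend a (by omega : a + b = m) (fun i => W i.succ))

/-- The canonical isomorphism, removing brackets, from the tensor product of the tensor products of
the successive blocks of the family `W` to the tensor product of `W`. -/
def tensorFlatten : {n : ℕ} → (k : Fin n → ℕ) → {s : ℕ} → (hk : ∑ i, k i = s) → (W : Fin s → C) →
    (tensorFin (fun i => tensorFin (fun j => W (blockIndex k hk i j))) ⟶ tensorFin W)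
  | 0, _, _, hk, _ => tensorEq (by simpa using hk) (fun i => i.elim0)
  | n + 1, k, s, hk, W =>
      have hk' : k 0 + ∑ i : Fin n, k i.succ = s := (Fin.sum_univ_succ k).symm.trans hk
      (tensorEq rfl (fun j => congrArg W (Fin.ext (by simp [blockIndex_val]))) ⊗ₘ
        (tensorFinMap (fun i => tensorEq rfl (fun j => congrArg W (Fin.ext (by
            simp [blockIndex_val, Fin.sum_univ_succ, Nat.add_assoc])))) ≫
          tensorFlatten (fun i : Fin n => k i.succ) rfl
            (fun p => W (Fin.cast hk' (Fin.natAdd (k 0) p))))) ≫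
      tensorAppend (k 0) hk' W

variable [BraidedCategory C]

/-- The canonical shuffle `(X 0 ⊗ Y 0) ⊗ (X 1 ⊗ Y 1) ⊗ ⋯ ⟶ (X 0 ⊗ X 1 ⊗ ⋯) ⊗ (Y 0 ⊗ Y 1 ⊗ ⋯)`. -/
def tensorShuffle : {n : ℕ} → (X Y : Fin n → C) →
    (tensorFin (fun i => X i ⊗ Y i) ⟶ tensorFin X ⊗ tensorFin Y)
  | 0, _, _ => (λ_ (𝟙_ C)).inv
  | _ + 1, X, Y =>
      ((X 0 ⊗ Y 0) ◁ tensorShuffle (fun i => X i.succ) (fun i => Y i.succ)) ≫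
        tensorμ (X 0) (Y 0) (tensorFin (fun i => X i.succ)) (tensorFin (fun i => Y i.succ))

/-- The canonical isomorphism moving the factor `X p` to the front and keeping the order of the
other factors. -/
def tensorPull : {n : ℕ} → (p : Fin (n + 1)) → (X : Fin (n + 1) → C) →
    (tensorFin X ⟶ X p ⊗ tensorFin (fun i => X (p.succAbove i)))
  | _, ⟨0, _⟩, X => X 0 ◁ tensorEq rfl (fun _ => congrArg X (by simp))
  | n + 1, ⟨q + 1, hq⟩, X =>
      let p : Fin (n + 1) := ⟨q, Nat.lt_of_succ_lt_succ hq⟩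
      let T : C := tensorFin (fun i : Fin n => X (p.succAbove i).succ)
      (X 0 ◁ tensorPull p (fun i => X i.succ)) ≫
        (α_ (X 0) (X p.succ) T).inv ≫ ((β_ (X 0) (X p.succ)).hom ▷ T) ≫
        (α_ (X p.succ) (X 0) T).hom ≫
        (X p.succ ◁ (X 0 ◁
          tensorEq rfl (fun i => congrArg X (Fin.succ_succAbove_succ p i).symm)))

/-- For a permutation `τ` of `n + 1` letters, the permutation `τ'` of `n` letters obtained by
removing `0` from the source and `τ 0` from the target and renumbering. -/
def permTail {n : ℕ} (τ : Equiv.Perm (Fin (n + 1))) : Equiv.Perm (Fin n) :=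
  ((finSuccAboveEquiv (0 : Fin (n + 1))).trans
    (τ.subtypeEquiv (fun a => by simp))).trans
    (finSuccAboveEquiv (τ 0)).symm

theorem succAbove_permTail {n : ℕ} (τ : Equiv.Perm (Fin (n + 1))) (i : Fin n) :
    (τ 0).succAbove (permTail τ i) = τ i.succ := by
  have h := (finSuccAboveEquiv (τ 0)).apply_symm_apply
    (τ.subtypeEquiv (p := fun a => a ≠ 0) (q := fun a => a ≠ τ 0) (fun a => by simp)
      (finSuccAboveEquiv (0 : Fin (n + 1)) i))
  have h' := congrArg Subtype.val h
  exact h'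

/-- The canonical isomorphism `X 0 ⊗ X 1 ⊗ ⋯ ⟶ X (τ 0) ⊗ X (τ 1) ⊗ ⋯` which permutes the
factors by means of the symmetry. -/
def tensorPerm : {n : ℕ} → (τ : Equiv.Perm (Fin n)) → (X : Fin n → C) →
    (tensorFin X ⟶ tensorFin (fun i => X (τ i)))
  | 0, _, _ => 𝟙 (𝟙_ C)
  | n + 1, τ, X =>
      tensorPull (τ 0) X ≫
        (X (τ 0) ◁ (tensorPerm (permTail τ) (fun i => X ((τ 0).succAbove i)) ≫
          tensorEq rfl (fun i : Fin n => congrArg X (succAbove_permTail τ i))))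

end Tensor

/-! ### Operads in a symmetric monoidal category -/

/-- The data of an operad with actions of the groups of an action operad `Λ`. A right action of
`Λ(n)` on `P(n)` (a map from the copower `P(n) ⊙ Λ(n) = ∐_{g ∈ Λ(n)} P(n)` to `P(n)`) is given by
its components `act g : P(n) ⟶ P(n)` for `g ∈ Λ(n)`. -/
structure LambdaOperadData (Λ : ActionOperad.{w}) (C : Type u) [Category.{v} C]
    [MonoidalCategory C] where
  obj : ℕ → C
  unit : 𝟙_ C ⟶ obj 1
  comp : ∀ {n : ℕ} (k : Fin n → ℕ) {m : ℕ}, ∑ i, k i = m →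
    (obj n ⊗ tensorFin (fun i => obj (k i)) ⟶ obj m)
  act : ∀ {n : ℕ}, Λ.obj n → (obj n ⟶ obj n)

section Operads

variable {Λ : ActionOperad.{w}} {C : Type u} [Category.{v} C] [MonoidalCategory C]

/-- The axioms of a `Λ`-operad: the operad axioms, the axioms of a right action, and the two
equivariance axioms. -/
structure LambdaOperadData.IsLambdaOperad [SymmetricCategory C] (P : LambdaOperadData Λ C) :
    Prop where
  unit_comp : ∀ {m : ℕ} (h : ∑ _i : Fin 1, m = m),
    (P.unit ▷ tensorFin (fun _ : Fin 1 => P.obj m)) ≫ P.comp (fun _ : Fin 1 => m) h =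
      (λ_ (tensorFin (fun _ : Fin 1 => P.obj m))).hom ≫ (ρ_ (P.obj m)).hom
  comp_unit : ∀ {n : ℕ} (h : ∑ _i : Fin n, 1 = n),
    (P.obj n ◁ tensorFinMap (fun _ : Fin n => P.unit)) ≫ P.comp (fun _ : Fin n => 1) h =
      (P.obj n ◁ tensorUnits n) ≫ (ρ_ (P.obj n)).hom
  assoc : ∀ {n : ℕ} (k : Fin n → ℕ) {s : ℕ} (hk : ∑ i, k i = s) (l : Fin s → ℕ) {m : ℕ}
    (hl : ∑ p, l p = m) (hl' : ∑ i, ∑ j, l (blockIndex k hk i j) = m),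
    (P.obj n ◁ tensorFinMap (fun i => P.comp (fun j => l (blockIndex k hk i j)) rfl)) ≫
        P.comp (fun i => ∑ j, l (blockIndex k hk i j)) hl' =
      (P.obj n ◁ (tensorShuffle (fun i => P.obj (k i))
          (fun i => tensorFin (fun j => P.obj (l (blockIndex k hk i j)))) ≫
          (tensorFin (fun i => P.obj (k i)) ◁ tensorFlatten k hk (fun p => P.obj (l p))))) ≫
        (α_ (P.obj n) (tensorFin (fun i => P.obj (k i)))
          (tensorFin (fun p => P.obj (l p)))).inv ≫
        (P.comp k hk ▷ tensorFin (fun p => P.obj (l p))) ≫ P.comp l hl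
  act_one : ∀ n : ℕ, P.act (1 : Λ.obj n) = 𝟙 (P.obj n)
  act_mul : ∀ {n : ℕ} (g h : Λ.obj n), P.act (g * h) = P.act g ≫ P.act h
  /-- `μ(x; y₁·g₁, …, yₙ·gₙ) = μ(x; y₁, …, yₙ) · μ(e; g₁, …, gₙ)` -/
  comp_act : ∀ {n : ℕ} (k : Fin n → ℕ) {m : ℕ} (h : ∑ i, k i = m) (g : ∀ i, Λ.obj (k i)),
    (P.obj n ◁ tensorFinMap (fun i => P.act (g i))) ≫ P.comp k h =
      P.comp k h ≫ P.act (Λ.comp k h 1 g)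
  /-- `μ(x·g; y₁, …, yₙ) = μ(x; y_{π(g)⁻¹(1)}, …, y_{π(g)⁻¹(n)}) · μ(g; e₁, …, eₙ)` -/
  act_comp : ∀ {n : ℕ} (k : Fin n → ℕ) {m : ℕ} (h : ∑ i, k i = m) (g : Λ.obj n),
    (P.act g ▷ tensorFin (fun i => P.obj (k i))) ≫ P.comp k h =
      (P.obj n ◁ tensorPerm (Λ.π n g).symm (fun i => P.obj (k i))) ≫
        P.comp (fun i => k ((Λ.π n g).symm i)) (sum_perm (Λ.π n g) k h) ≫
        P.act (Λ.comp k h g (fun _ => 1))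

variable (Λ C) in
/-- A `Λ`-operad in the symmetric monoidal category `C`. -/
structure LambdaOperad [SymmetricCategory C] where
  data : LambdaOperadData Λ C
  isLambdaOperad : data.IsLambdaOperad

/-- A map of `Λ`-operads: a family of equivariant maps preserving units and composition. -/
@[ext]
structure LambdaOperadHom [SymmetricCategory C] (P Q : LambdaOperad Λ C) where
  app : ∀ n, P.data.obj n ⟶ Q.data.obj n
  unit_app : P.data.unit ≫ app 1 = Q.data.unit
  comp_app : ∀ {n : ℕ} (k : Fin n → ℕ) {m : ℕ} (h : ∑ i, k i = m),
    P.data.comp k h ≫ app m =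
      (app n ⊗ₘ tensorFinMap (fun i => app (k i))) ≫ Q.data.comp k h
  act_app : ∀ {n : ℕ} (g : Λ.obj n), P.data.act g ≫ app n = app n ≫ Q.data.act g

instance [SymmetricCategory C] : Category (LambdaOperad Λ C) where
  Hom P Q := LambdaOperadHom P Q
  id P :=
    { app := fun n => 𝟙 (P.data.obj n)
      unit_app := by simp
      comp_app := fun k m h => by simp [tensorFinMap_id]
      act_app := by simp }
  comp {P Q R} f g :=
    { app := fun n => f.app n ≫ g.app n
      unit_app := by rw [← Category.assoc, f.unit_app, g.unit_app]
      comp_app := fun k m h => by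
        rw [← Category.assoc, f.comp_app, Category.assoc, g.comp_app, ← Category.assoc,
          MonoidalCategory.tensorHom_comp_tensorHom, ← tensorFinMap_comp]
      act_app := fun g' => by
        rw [← Category.assoc, f.act_app, Category.assoc, g.act_app, Category.assoc] }
  id_comp f := LambdaOperadHom.ext (funext fun n => Category.id_comp (f.app n))
  comp_id f := LambdaOperadHom.ext (funext fun n => Category.comp_id (f.app n))
  assoc f g h := LambdaOperadHom.ext
    (funext fun n => Category.assoc (f.app n) (g.app n) (h.app n))

/-! ### Transport along a lax monoidal functor -/

variable {D : Type u'} [Category.{v'} D] [MonoidalCategory D]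

/-- The iterated constraint `F(X 0) ⊗ F(X 1) ⊗ ⋯ ⟶ F(X 0 ⊗ X 1 ⊗ ⋯)` of a lax monoidal functor. -/
def laxTensorFin (F : C ⥤ D) [F.LaxMonoidal] : {n : ℕ} → (X : Fin n → C) →
    (tensorFin (fun i => F.obj (X i)) ⟶ F.obj (tensorFin X))
  | 0, _ => Functor.LaxMonoidal.ε F
  | _ + 1, X =>
      (F.obj (X 0) ◁ laxTensorFin F (fun i => X i.succ)) ≫
        Functor.LaxMonoidal.μ F (X 0) (tensorFin (fun i => X i.succ))

/-- The canonical structure on `{F(P(n))}`: the structure maps are the images under `F` of those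
of `P`, precomposed with the constraints of the lax monoidal functor `F`. -/
def LambdaOperadData.map (F : C ⥤ D) [F.LaxMonoidal] (P : LambdaOperadData Λ C) :
    LambdaOperadData Λ D where
  obj n := F.obj (P.obj n)
  unit := Functor.LaxMonoidal.ε F ≫ F.map P.unit
  comp {n} k _ h :=
    (F.obj (P.obj n) ◁ laxTensorFin F (fun i => P.obj (k i))) ≫
      Functor.LaxMonoidal.μ F (P.obj n) (tensorFin (fun i => P.obj (k i))) ≫ F.map (P.comp k h)
  act g := F.map (P.act g)

end Operads

/-! ### The action operad as a `Λ`-operad of sets, and its translation categories -/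

/-- The components of an element of an iterated product of sets. -/
def tensorFinComponents : {n : ℕ} → {X : Fin n → Type w} → tensorFin X → ∀ i, X i
  | 0, _, _ => fun i => i.elim0
  | _ + 1, X, p => Fin.cases (motive := X) p.1
      (tensorFinComponents (X := fun i => X i.succ) p.2)

/-- `Λ` itself, with its operad structure and the right multiplication actions. -/
def ActionOperad.regular (Λ : ActionOperad.{w}) : LambdaOperadData Λ (Type w) where
  obj n := Λ.obj n
  unit := TypeCat.ofHom (fun _ => Λ.one)
  comp k _ h := TypeCat.ofHom (fun p => Λ.comp k h p.1 (tensorFinComponents p.2))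
  act g := TypeCat.ofHom (fun x => x * g)

/-- The translation category `EX` of a set `X`: the objects are the elements of `X` and there is
exactly one morphism between any two objects. -/
structure Translation (X : Type w) : Type w where
  as : X

instance (X : Type w) : Category.{w} (Translation X) where
  Hom _ _ := PUnit.{w + 1}
  id _ := ⟨⟩
  comp _ _ := ⟨⟩

instance (X : Type w) (x y : Translation X) : Subsingleton (x ⟶ y) :=
  inferInstanceAs (Subsingleton PUnit)

/-- The functor `C ⥤ EX` with a given effect on objects. -/
def Translation.lift {C : Type u} [Category.{v} C] {X : Type w} (f : C → X) :
    C ⥤ Translation X where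
  obj c := ⟨f c⟩
  map _ := ⟨⟩

theorem Translation.functor_ext {C : Type u} [Category.{v} C] {X : Type w}
    {F G : C ⥤ Translation X} (h : ∀ c, (F.obj c).as = (G.obj c).as) : F = G :=
  CategoryTheory.Functor.ext
    (fun c => congrArg Translation.mk (h c)) (fun _ _ _ => Subsingleton.elim _ _)

/-- The functor `E` from sets to small categories. -/
def translation : Type w ⥤ Cat.{w, w} where
  obj X := Cat.of (Translation X)
  map f := (Translation.lift (fun x => f x.as)).toCatHom

/-- `E`, as a symmetric monoidal functor for the cartesian structures: the constraints are
`* ↦ *` and `(x, y) ↦ (x, y)` on objects. -/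
instance : translation.{w}.LaxBraided where
  ε := (Translation.lift (C := (𝟙_ Cat.{w, w} :)) (X := PUnit.{w + 1})
    (fun _ => PUnit.unit)).toCatHom
  μ X Y := (Translation.lift (X := X × Y)
    (fun p : Translation X × Translation Y => (p.1.as, p.2.as))).toCatHom
  μ_natural_left _ _ := Cat.Hom.ext (Translation.functor_ext fun _ => rfl)
  μ_natural_right _ _ := Cat.Hom.ext (Translation.functor_ext fun _ => rfl)
  associativity _ _ _ := Cat.Hom.ext (Translation.functor_ext fun _ => rfl)
  left_unitality _ := Cat.Hom.ext (Translation.functor_ext fun _ => rfl)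
  right_unitality _ := Cat.Hom.ext (Translation.functor_ext fun _ => rfl)
  braided _ _ := Cat.Hom.ext (Translation.functor_ext fun _ => rfl)

/-- The `Λ`-operad structure of `EΛ = {E(Λ(n))}`: the image of `Λ` under `E`. -/
def ActionOperad.translationOperad (Λ : ActionOperad.{w}) : LambdaOperadData Λ Cat.{w, w} :=
  Λ.regular.map translation

/-- A `Λ_∞` operad in `Cat`: the action of each `Λ(n)` on `P(n)` is free (an element fixing some
object, and so in particular an element fixing some morphism, is the identity element) and each
`P(n)` is contractible, that is, equivalent to the terminal category. -/
structure LambdaOperad.IsLambdaInfinity {Λ : ActionOperad.{w}}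
    (P : LambdaOperad Λ Cat.{v, u}) : Prop where
  free : ∀ (n : ℕ) (g : Λ.obj n) (x : P.data.obj n), (P.data.act g).toFunctor.obj x = x → g = 1
  contractible : ∀ n, Nonempty (P.data.obj n ≌ Discrete PUnit.{1})

end LambdaOp

open LambdaOp

/-!
A lax monoidal functor `F` transports operads because every canonical isomorphism that occurs in the
axioms of an operad is compatible with the iterated constraint
`F(X 0) ⊗ F(X 1) ⊗ ⋯ ⟶ F(X 0 ⊗ X 1 ⊗ ⋯)`. These isomorphisms are built by recursion from unitors,
associators and the symmetry, and their compatibilities follow by induction from the coherence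
axioms of `F`: unitors for `laxTensorFin_tensorUnits`, associators for `laxTensorFin_tensorAppend`
and `laxTensorFin_tensorFlatten`, and the symmetry for `laxTensorFin_tensorShuffle` and
`laxTensorFin_tensorPerm`. Given these, each axiom for `{F(P(n))}` is the image under `F` of the
same axiom for `P`, preceded by a constraint (`LambdaOperadData.IsLambdaOperad.map`).

In the category of sets every element of an iterated product is the family `tensorFinMk x` of its
components, and the canonical isomorphisms only reindex such families (`tensorFlatten_mk`,
`tensorShuffle_mk`, `tensorPerm_mk`). The axioms for `Λ` acting on itself then become the
associativity and unit laws of `Λ`, the group laws, and two special cases of the interchange law of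
an action operad (`ActionOperad.regular_isLambdaOperad`).

The operad `EΛ` is the image of `Λ` under `E`. On objects the action is right multiplication,
which is free, and a translation category on a nonempty set is equivalent to the terminal category.
-/

namespace LambdaOp

/-! ### The iterated constraint of a lax monoidal functor -/

section Lax

variable {C : Type u} [Category.{v} C] [MonoidalCategory C]
  {D : Type u'} [Category.{v'} D] [MonoidalCategory D]

open Functor.LaxMonoidal

theorem tensorEq_refl {n : ℕ} (X : Fin n → C) (h : n = n) (hX : ∀ i, X i = X (Fin.cast h i)) :
    tensorEq h hX = 𝟙 (tensorFin X) := rfl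

theorem laxTensorFin_natural (F : C ⥤ D) [F.LaxMonoidal] : ∀ {n : ℕ} {X Y : Fin n → C}
    (f : ∀ i, X i ⟶ Y i),
    tensorFinMap (fun i => F.map (f i)) ≫ laxTensorFin F Y =
      laxTensorFin F X ≫ F.map (tensorFinMap f)
  | 0, _, _, _ => by simp [tensorFinMap, laxTensorFin, tensorFin]
  | n + 1, X, Y, f => by
      have ih := laxTensorFin_natural F (fun i : Fin n => f i.succ)
      simp only [tensorFin, tensorFinMap, laxTensorFin, Category.assoc]
      rw [MonoidalCategory.tensorHom_def, Category.assoc, ← whiskerLeft_comp_assoc, ih,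
        whiskerLeft_comp_assoc, ← whisker_exchange_assoc, μ_natural_right, μ_natural_left_assoc,
        ← F.map_comp, ← MonoidalCategory.tensorHom_def]

/-- `hXY'` is a separate argument so that the lemma applies to `tensorEq` with any proof of the
equality of the image families. -/
theorem tensorEq_laxTensorFin (F : C ⥤ D) [F.LaxMonoidal] {a b : ℕ} (h : a = b)
    {X : Fin a → C} {Y : Fin b → C} (hXY : ∀ i, X i = Y (Fin.cast h i))
    (hXY' : ∀ i, F.obj (X i) = F.obj (Y (Fin.cast h i))) :
    tensorEq h (X := fun i => F.obj (X i)) (Y := fun i => F.obj (Y i)) hXY' ≫ laxTensorFin F Y =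
      laxTensorFin F X ≫ F.map (tensorEq h hXY) := by
  subst h
  obtain rfl : X = Y := funext hXY
  simp [tensorEq_refl]

theorem laxTensorFin_tensorUnits (F : C ⥤ D) [F.LaxMonoidal] : ∀ n : ℕ,
    tensorFinMap (fun _ : Fin n => ε F) ≫ laxTensorFin F (fun _ : Fin n => 𝟙_ C) ≫
      F.map (tensorUnits n) = tensorUnits n ≫ ε F
  | 0 => by simp [tensorFinMap, laxTensorFin, tensorUnits, tensorFin]
  | n + 1 => by
      have ih := laxTensorFin_tensorUnits F n
      simp only [tensorFin, tensorFinMap, laxTensorFin, tensorUnits, Category.assoc, ← ih]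
      rw [MonoidalCategory.tensorHom_def', Category.assoc, ← leftUnitor_naturality_assoc,
        F.map_comp, ← leftUnitor_naturality_assoc, left_unitality_assoc]
      simp only [whisker_exchange_assoc]

/-- Inductive step for `laxTensorFin_tensorAppend`: a square comparing `t'` with `F.map t` yields
the square for the map obtained by putting `W` in front. Subscripts `₀` mark objects of the target
category, and `a`, `b`, `s` stand for iterated constraints. -/
theorem lax_append_cons (F : C ⥤ D) [F.LaxMonoidal] {W A B B' S : C} {A₀ B₀ B₀' S₀ : D}
    (a : A₀ ⟶ F.obj A) (b : B₀ ⟶ F.obj B) (b' : B₀' ⟶ F.obj B') (s : S₀ ⟶ F.obj S)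
    (e : B ⟶ B') (e' : B₀ ⟶ B₀') (t : A ⊗ B' ⟶ S) (t' : A₀ ⊗ B₀' ⟶ S₀)
    (he : e' ≫ b' = b ≫ F.map e) (ht : (a ⊗ₘ b') ≫ μ F A B' ≫ F.map t = t' ≫ s) :
    ((F.obj W ◁ a) ≫ μ F W A ⊗ₘ b) ≫ μ F (W ⊗ A) B ≫
        F.map ((α_ W A B).hom ≫ (W ◁ (A ◁ e)) ≫ (W ◁ t)) =
      ((α_ (F.obj W) A₀ B₀).hom ≫ (F.obj W ◁ (A₀ ◁ e')) ≫ (F.obj W ◁ t')) ≫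
        (F.obj W ◁ s) ≫ μ F W S := by
  have h₁ : (A₀ ◁ e') ≫ (a ⊗ₘ b') = (a ⊗ₘ b) ≫ (F.obj A ◁ F.map e) := by
    rw [← id_tensorHom, ← id_tensorHom, MonoidalCategory.tensorHom_comp_tensorHom,
      MonoidalCategory.tensorHom_comp_tensorHom, he, Category.id_comp, Category.comp_id]
  have h₂ : (α_ (F.obj W) A₀ B₀).hom ≫ (F.obj W ◁ (a ⊗ₘ b)) =
      (((F.obj W ◁ a) ⊗ₘ b)) ≫ (α_ (F.obj W) (F.obj A) (F.obj B)).hom := by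
    simp only [← id_tensorHom, associator_naturality]
  have h₃ : ((F.obj W ◁ a) ≫ μ F W A ⊗ₘ b) =
      ((F.obj W ◁ a) ⊗ₘ b) ≫ (μ F W A ▷ F.obj B) := by
    rw [← tensorHom_id, MonoidalCategory.tensorHom_comp_tensorHom, Category.comp_id]
  rw [h₃]
  simp only [Category.assoc, F.map_comp]
  rw [← whiskerLeft_comp_assoc, ← whiskerLeft_comp_assoc, Category.assoc, ← ht,
    ← Category.assoc (A₀ ◁ e'), h₁, Category.assoc, whiskerLeft_comp_assoc, reassoc_of% h₂,
    associativity_assoc]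
  simp

theorem laxTensorFin_tensorAppend (F : C ⥤ D) [F.LaxMonoidal] : ∀ (a : ℕ) {b m : ℕ}
    (h : a + b = m) (W : Fin m → C),
    (laxTensorFin F (fun i : Fin a => W (Fin.cast h (Fin.castAdd b i))) ⊗ₘ
      laxTensorFin F (fun j : Fin b => W (Fin.cast h (Fin.natAdd a j)))) ≫
      μ F _ _ ≫ F.map (tensorAppend a h W) =
    tensorAppend a h (fun i => F.obj (W i)) ≫ laxTensorFin F W
  | 0, b, m, h, W => by
      simp only [tensorFin, tensorAppend, laxTensorFin, Category.assoc, F.map_comp]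
      rw [tensorEq_laxTensorFin F _ (fun j => congrArg W (Fin.ext (by simp))),
        MonoidalCategory.tensorHom_def', Category.assoc]
      -- The empty tensor product is only definitionally equal to the unit.
      erw [← left_unitality_assoc]
      rw [leftUnitor_naturality_assoc]
  | a + 1, b, 0, h, W => absurd h (by omega)
  | a + 1, b, m + 1, h, W => by
      have ih := laxTensorFin_tensorAppend F a (by omega : a + b = m) (fun i => W i.succ)
      have hE := tensorEq_laxTensorFin F (rfl : b = b)
        (X := fun j => W (Fin.cast h (Fin.natAdd (a + 1) j)))
        (Y := fun j => W (Fin.cast (by omega : a + b = m) (Fin.natAdd a j)).succ)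
        (fun j => congrArg W (Fin.ext (Nat.succ_add_eq_add_succ a j)))
        (fun j => congrArg (fun i => F.obj (W i)) (Fin.ext (Nat.succ_add_eq_add_succ a j)))
      exact lax_append_cons F _ _ _ _ _ _ _ _ hE ih

/-- Inductive step for `laxTensorFin_tensorFlatten`: the squares for the identifications `e`, `e'`
of the first block, for the maps `g`, `g'` flattening the other blocks, and for the maps `t`, `t'`
joining the two parts are pasted. -/
theorem lax_flatten_cons (F : C ⥤ D) [F.LaxMonoidal] {A A' T B S : C} {A₀ A₀' T₀ T₁ B₀ S₀ : D}
    (a : A₀ ⟶ F.obj A) (a' : A₀' ⟶ F.obj A') (r : T₀ ⟶ T₁) (r' : T₁ ⟶ F.obj T)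
    (b : B₀ ⟶ F.obj B) (s : S₀ ⟶ F.obj S) (e : A ⟶ A') (e' : A₀ ⟶ A₀') (g : T ⟶ B) (g' : T₀ ⟶ B₀)
    (t : A' ⊗ B ⟶ S) (t' : A₀' ⊗ B₀ ⟶ S₀)
    (he : e' ≫ a' = a ≫ F.map e) (hg : g' ≫ b = r ≫ r' ≫ F.map g)
    (ht : (a' ⊗ₘ b) ≫ μ F A' B ≫ F.map t = t' ≫ s) :
    (a ⊗ₘ r) ≫ ((F.obj A ◁ r') ≫ μ F A T) ≫ F.map ((e ⊗ₘ g) ≫ t) = ((e' ⊗ₘ g') ≫ t') ≫ s := by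
  rw [Category.assoc (e' ⊗ₘ g'), ← ht, MonoidalCategory.tensorHom_comp_tensorHom_assoc, he, hg,
    F.map_comp, Category.assoc, ← μ_natural_assoc, ← id_tensorHom]
  simp only [MonoidalCategory.tensorHom_comp_tensorHom_assoc, Category.id_comp]

theorem tensorFinMap_comp_assoc {n : ℕ} {X Y Z : Fin n → C} (f : ∀ i, X i ⟶ Y i)
    (g : ∀ i, Y i ⟶ Z i) {T : C} (t : tensorFin Z ⟶ T) :
    tensorFinMap (fun i => f i ≫ g i) ≫ t = tensorFinMap f ≫ tensorFinMap g ≫ t := by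
  rw [tensorFinMap_comp, Category.assoc]

theorem laxTensorFin_tensorFlatten (F : C ⥤ D) [F.LaxMonoidal] : ∀ {n : ℕ} (k : Fin n → ℕ) {s : ℕ}
    (hk : ∑ i, k i = s) (W : Fin s → C),
    tensorFinMap (fun i => laxTensorFin F (fun j => W (blockIndex k hk i j))) ≫
      laxTensorFin F (fun i => tensorFin (fun j => W (blockIndex k hk i j))) ≫
        F.map (tensorFlatten k hk W) =
    tensorFlatten k hk (fun p => F.obj (W p)) ≫ laxTensorFin F W
  | 0, k, s, hk, W => by
      have hE := tensorEq_laxTensorFin F (by simpa using hk : 0 = s)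
        (X := fun i => tensorFin (fun j => W (blockIndex k hk i j))) (Y := W)
        (fun i => i.elim0) (fun i => i.elim0)
      have h1 : tensorFinMap (fun i => laxTensorFin F (fun j => W (blockIndex k hk i j))) =
        𝟙 (𝟙_ D) := rfl
      rw [h1]
      exact (Category.id_comp _).trans hE.symm
  | n + 1, k, s, hk, W => by
      have hk' : k 0 + ∑ i : Fin n, k i.succ = s := (Fin.sum_univ_succ k).symm.trans hk
      have ih := laxTensorFin_tensorFlatten F (fun i : Fin n => k i.succ) rfl
            (fun p => W (Fin.cast hk' (Fin.natAdd (k 0) p)))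
      have hA := laxTensorFin_tensorAppend F (k 0) hk' W
      refine lax_flatten_cons F _ _ _ _ _ _ _ _ _ _ _ _
        (tensorEq_laxTensorFin F rfl (X := fun j => W (blockIndex k hk 0 j))
          (Y := fun i => W (Fin.cast hk' (Fin.castAdd (∑ i : Fin n, k i.succ) i)))
          (fun j => congrArg W (Fin.ext (by simp [blockIndex_val]))) _) ?_ hA
      -- The remaining square says that the identifications of the later blocks commute with the
      -- constraints.
      rw [Category.assoc, ← ih, ← tensorFinMap_comp_assoc, F.map_comp,
        ← reassoc_of% (laxTensorFin_natural F), ← tensorFinMap_comp_assoc]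
      congr 2
      funext i
      exact tensorEq_laxTensorFin F rfl (X := fun j => W (blockIndex k hk i.succ j))
        (Y := fun j => W (Fin.cast hk' (Fin.natAdd (k 0) (blockIndex (fun i => k i.succ) rfl i j))))
        (fun j => congrArg W (Fin.ext (by
          simp [blockIndex_val, Fin.sum_univ_succ, Nat.add_assoc]))) _

/-- Inductive step for `laxTensorFin_tensorPerm`: the squares for pulling one factor to the front,
for permuting the other factors, and for an identification of the result are pasted. -/
theorem lax_perm_cons (F : C ⥤ D) [F.LaxMonoidal] {X U T T' T'' : C} {U₀ T₀ T₀' T₀'' : D}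
    (u : U₀ ⟶ F.obj U) (t : T₀ ⟶ F.obj T) (t' : T₀' ⟶ F.obj T') (t'' : T₀'' ⟶ F.obj T'')
    (p : U ⟶ X ⊗ T) (p' : U₀ ⟶ F.obj X ⊗ T₀) (q : T ⟶ T') (q' : T₀ ⟶ T₀')
    {e : T' ⟶ T''} (e' : T₀' ⟶ T₀'')
    (hp : u ≫ F.map p = p' ≫ (F.obj X ◁ t) ≫ μ F X T) (hq : t ≫ F.map q = q' ≫ t')
    (he : e' ≫ t'' = t' ≫ F.map e) :
    u ≫ F.map (p ≫ (X ◁ (q ≫ e))) =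
      (p' ≫ (F.obj X ◁ (q' ≫ e'))) ≫ (F.obj X ◁ t'') ≫ μ F X T'' := by
  rw [F.map_comp, reassoc_of% hp, ← μ_natural_right, F.map_comp, Category.assoc,
    ← whiskerLeft_comp_assoc, ← whiskerLeft_comp_assoc, reassoc_of% hq, ← he, Category.assoc]

/-- The constraints can be collected in front of a two-fold composite `d ∘ (c ⊗ 1)`. This
is the right-hand side of the associativity axiom for `{F(P(n))}`. -/
theorem lax_whiskerLeft_comp (F : C ⥤ D) [F.LaxMonoidal] {A K L S M : C} {K₀ L₀ : D}
    (a : K₀ ⟶ F.obj K) (b : L₀ ⟶ F.obj L) (c : A ⊗ K ⟶ S) (d : S ⊗ L ⟶ M) :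
    (α_ (F.obj A) K₀ L₀).inv ≫ (((F.obj A ◁ a) ≫ μ F A K ≫ F.map c) ▷ L₀) ≫
        (F.obj S ◁ b) ≫ μ F S L ≫ F.map d =
      (F.obj A ◁ ((a ⊗ₘ b) ≫ μ F K L)) ≫ μ F A (K ⊗ L) ≫
        F.map ((α_ A K L).inv ≫ (c ▷ L) ≫ d) := by
  rw [← whisker_exchange_assoc, comp_whiskerRight_assoc, comp_whiskerRight_assoc,
    μ_natural_left_assoc, MonoidalCategory.tensorHom_def]
  simp only [MonoidalCategory.whiskerLeft_comp, Category.assoc, F.map_comp]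
  rw [associativity_inv_assoc, associator_inv_naturality_right_assoc,
    associator_inv_naturality_middle_assoc, whisker_exchange_assoc]

end Lax

/-! ### Compatibility of the iterated constraint with the symmetry -/

section LaxBraided

variable {C : Type u} [Category.{v} C] [MonoidalCategory C] [BraidedCategory C]
  {D : Type u'} [Category.{v'} D] [MonoidalCategory D] [BraidedCategory D]

open Functor.LaxMonoidal

/-- Naturality of the shuffle. -/
theorem tensorFinMap_tensorShuffle : ∀ {n : ℕ} {X Y X' Y' : Fin n → C} (f : ∀ i, X i ⟶ X' i)
    (g : ∀ i, Y i ⟶ Y' i),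
    tensorFinMap (fun i => f i ⊗ₘ g i) ≫ tensorShuffle X' Y' =
      tensorShuffle X Y ≫ (tensorFinMap f ⊗ₘ tensorFinMap g)
  | 0, _, _, _, _, _, _ => by simp [tensorFinMap, tensorShuffle, tensorFin]
  | n + 1, X, Y, X', Y', f, g => by
      have ih := tensorFinMap_tensorShuffle (fun i : Fin n => f i.succ) (fun i => g i.succ)
      simp only [tensorFin, tensorFinMap, tensorShuffle, Category.assoc]
      rw [← tensorμ_natural, ← id_tensorHom, ← id_tensorHom,
        MonoidalCategory.tensorHom_comp_tensorHom_assoc,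
        MonoidalCategory.tensorHom_comp_tensorHom_assoc, ih, Category.id_comp, Category.comp_id]

theorem laxTensorFin_tensorShuffle (F : C ⥤ D) [F.LaxBraided] : ∀ {n : ℕ} (X Y : Fin n → C),
    tensorFinMap (fun i => μ F (X i) (Y i)) ≫ laxTensorFin F (fun i => X i ⊗ Y i) ≫
      F.map (tensorShuffle X Y) =
    tensorShuffle (fun i => F.obj (X i)) (fun i => F.obj (Y i)) ≫
      (laxTensorFin F X ⊗ₘ laxTensorFin F Y) ≫ μ F (tensorFin X) (tensorFin Y)
  | 0, X, Y => by
      simp only [tensorFin, tensorFinMap, tensorShuffle, laxTensorFin, Category.id_comp]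
      rw [← left_unitality_inv, MonoidalCategory.tensorHom_def', Category.assoc,
        leftUnitor_inv_naturality_assoc]
  | n + 1, X, Y => by
      have ih := laxTensorFin_tensorShuffle F (fun i : Fin n => X i.succ) (fun i => Y i.succ)
      have hμ := tensorμ_comp_μ_tensorHom_μ_comp_μ F (X 0) (Y 0) (tensorFin fun i => X i.succ)
        (tensorFin fun i => Y i.succ)
      simp only [tensorFin, tensorFinMap, tensorShuffle, laxTensorFin, Category.assoc, F.map_comp]
      rw [← MonoidalCategory.tensorHom_comp_tensorHom_assoc, ← id_tensorHom (F.obj (X 0)),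
        ← id_tensorHom (F.obj (Y 0)), ← tensorμ_natural_assoc, hμ, ← id_tensorHom, ← id_tensorHom,
        ← id_tensorHom, ← μ_natural_assoc]
      simp only [MonoidalCategory.tensorHom_comp_tensorHom_assoc, Category.id_comp,
        Category.comp_id, F.map_id, id_tensorHom_id, ih]

/-- Inductive step for `laxTensorFin_tensorPull`: once `Y` has been pulled to the front of the tail,
it is exchanged with the first factor `X`. -/
theorem lax_pull_cons (F : C ⥤ D) [F.LaxBraided] {X Y U T T' : C} {U₀ T₀ T₀' : D}
    (u : U₀ ⟶ F.obj U) (t : T₀ ⟶ F.obj T) (t' : T₀' ⟶ F.obj T') (p : U ⟶ Y ⊗ T)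
    (p' : U₀ ⟶ F.obj Y ⊗ T₀) (e : T ⟶ T') (e' : T₀ ⟶ T₀')
    (hp : u ≫ F.map p = p' ≫ (F.obj Y ◁ t) ≫ μ F Y T) (he : e' ≫ t' = t ≫ F.map e) :
    ((F.obj X ◁ u) ≫ μ F X U) ≫ F.map ((X ◁ p) ≫ (α_ X Y T).inv ≫ ((β_ X Y).hom ▷ T) ≫
        (α_ Y X T).hom ≫ (Y ◁ (X ◁ e))) =
      ((F.obj X ◁ p') ≫ (α_ (F.obj X) (F.obj Y) T₀).inv ≫
        ((β_ (F.obj X) (F.obj Y)).hom ▷ T₀) ≫ (α_ (F.obj Y) (F.obj X) T₀).hom ≫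
        (F.obj Y ◁ (F.obj X ◁ e'))) ≫ (F.obj Y ◁ ((F.obj X ◁ t') ≫ μ F X T')) ≫
          μ F Y (X ⊗ T') := by
  have h₁ : (F.obj Y ◁ (F.obj X ◁ e')) ≫ (F.obj Y ◁ ((F.obj X ◁ t') ≫ μ F X T')) ≫
      μ F Y (X ⊗ T') = (F.obj Y ◁ (F.obj X ◁ t)) ≫ (F.obj Y ◁ μ F X T) ≫ μ F Y (X ⊗ T) ≫
        F.map (Y ◁ (X ◁ e)) := by
    rw [← μ_natural_right, ← whiskerLeft_comp_assoc, ← whiskerLeft_comp_assoc,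
      ← whiskerLeft_comp_assoc, ← whiskerLeft_comp_assoc, he]
    simp
  simp only [Category.assoc, h₁]
  rw [F.map_comp, ← μ_natural_right_assoc, ← whiskerLeft_comp_assoc, hp]
  simp only [MonoidalCategory.whiskerLeft_comp, Category.assoc, F.map_comp]
  rw [associativity_inv_assoc, ← μ_natural_left_assoc, ← comp_whiskerRight_assoc,
    Functor.LaxBraided.braided, comp_whiskerRight_assoc, associativity_assoc,
    associator_inv_naturality_right_assoc, whisker_exchange_assoc,
    associator_naturality_right_assoc]

theorem laxTensorFin_tensorPull (F : C ⥤ D) [F.LaxBraided] : ∀ {n : ℕ} (p : Fin (n + 1))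
    (X : Fin (n + 1) → C),
    laxTensorFin F X ≫ F.map (tensorPull p X) =
      tensorPull p (fun i => F.obj (X i)) ≫
        (F.obj (X p) ◁ laxTensorFin F (fun i => X (p.succAbove i))) ≫
          μ F (X p) (tensorFin fun i => X (p.succAbove i))
  | n, ⟨0, h0⟩, X => by
      have hE := tensorEq_laxTensorFin F (rfl : n = n)
        (X := fun i => X i.succ) (Y := fun i => X ((⟨0, h0⟩ : Fin (n + 1)).succAbove i))
        (fun _ => congrArg X (by simp)) (fun _ => congrArg (fun i => F.obj (X i)) (by simp))
      have h : ∀ {Y : C} {A B : D} {a : A ⟶ F.obj Y} {Z : C} {b : B ⟶ F.obj Z} {e : Y ⟶ Z}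
          {e' : A ⟶ B}, e' ≫ b = a ≫ F.map e →
          ((F.obj (X 0) ◁ a) ≫ μ F (X 0) Y) ≫ F.map (X 0 ◁ e) =
            (F.obj (X 0) ◁ e') ≫ (F.obj (X 0) ◁ b) ≫ μ F (X 0) Z := by
        intro Y A B a Z b e e' h
        rw [← whiskerLeft_comp_assoc, h, Category.assoc, ← μ_natural_right, whiskerLeft_comp_assoc]
      rw [tensorPull, tensorPull]
      exact h hE
  | n + 1, ⟨q + 1, hq⟩, X => by
      have ih := laxTensorFin_tensorPull F ⟨q, Nat.lt_of_succ_lt_succ hq⟩ (fun i => X i.succ)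
      refine lax_pull_cons F _ _ _ _ _ _ _ ih (tensorEq_laxTensorFin F rfl
        (Y := fun i : Fin n => X ((⟨q + 1, hq⟩ : Fin (n + 2)).succAbove i.succ)) _ _)

theorem laxTensorFin_tensorPerm (F : C ⥤ D) [F.LaxBraided] : ∀ {n : ℕ} (τ : Equiv.Perm (Fin n))
    (X : Fin n → C),
    laxTensorFin F X ≫ F.map (tensorPerm τ X) =
      tensorPerm τ (fun i => F.obj (X i)) ≫ laxTensorFin F (fun i => X (τ i))
  | 0, _, X => by
      simp [tensorFin, tensorPerm, laxTensorFin]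
  | n + 1, τ, X => by
      have ih := laxTensorFin_tensorPerm F (permTail τ) (fun i => X ((τ 0).succAbove i))
      have hP := laxTensorFin_tensorPull F (τ 0) X
      have hE := tensorEq_laxTensorFin F (rfl : n = n)
        (X := fun i => X ((τ 0).succAbove (permTail τ i))) (Y := fun i => X (τ i.succ))
        (fun i => congrArg X (succAbove_permTail τ i))
        (fun i => congrArg (fun i => F.obj (X i)) (succAbove_permTail τ i))
      exact lax_perm_cons F _ _ _ _ _ _ _ _ _ hP ih hE

end LaxBraided

/-! ### The image of an operad under a symmetric lax monoidal functor -/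

section Map
open Functor.LaxMonoidal
variable {Λ : ActionOperad.{w}} {C : Type u} [Category.{v} C] [MonoidalCategory C]
  [SymmetricCategory C] {D : Type u'} [Category.{v'} D] [MonoidalCategory D] [SymmetricCategory D]

/-- Compatibility of the constraints with the rearrangement of the inputs in the associativity
axiom. -/
theorem laxTensorFin_shuffle_flatten (F : C ⥤ D) [F.LaxBraided] {n : ℕ} (X : Fin n → C)
    (k : Fin n → ℕ) {s : ℕ} (hk : ∑ i, k i = s) (W : Fin s → C) :
    tensorFinMap (fun i => (F.obj (X i) ◁ laxTensorFin F (fun j => W (blockIndex k hk i j))) ≫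
        μ F (X i) (tensorFin (fun j => W (blockIndex k hk i j)))) ≫
      laxTensorFin F (fun i => X i ⊗ tensorFin (fun j => W (blockIndex k hk i j))) ≫
        F.map (tensorShuffle X (fun i => tensorFin (fun j => W (blockIndex k hk i j))) ≫
          (tensorFin X ◁ tensorFlatten k hk W)) =
    tensorShuffle (fun i => F.obj (X i))
        (fun i => tensorFin (fun j => F.obj (W (blockIndex k hk i j)))) ≫
      (tensorFin (fun i => F.obj (X i)) ◁ tensorFlatten k hk (fun p => F.obj (W p))) ≫
      (laxTensorFin F X ⊗ₘ laxTensorFin F W) ≫ μ F (tensorFin X) (tensorFin W) := by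
  have h := tensorFinMap_tensorShuffle (fun i => 𝟙 (F.obj (X i)))
    (fun i => laxTensorFin F (fun j => W (blockIndex k hk i j)))
  simp only [id_tensorHom, tensorFinMap_id] at h
  rw [tensorFinMap_comp_assoc, F.map_comp, reassoc_of% (laxTensorFin_tensorShuffle F),
    reassoc_of% h, ← μ_natural_right]
  simp only [← id_tensorHom, MonoidalCategory.tensorHom_comp_tensorHom_assoc, Category.id_comp,
    Category.comp_id, laxTensorFin_tensorFlatten]

/-- A symmetric lax monoidal functor sends `Λ`-operads to `Λ`-operads. -/
theorem LambdaOperadData.IsLambdaOperad.map {P : LambdaOperadData Λ C} (hP : P.IsLambdaOperad)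
    (F : C ⥤ D) [F.LaxBraided] : (P.map F).IsLambdaOperad where
  unit_comp {m} h := by
    -- `r`, `r'` are right unitors, with the one-fold iterated tensor product as source.
    let r : tensorFin (fun _ : Fin 1 => P.obj m) ⟶ P.obj m := (ρ_ (P.obj m)).hom
    let r' : tensorFin (fun _ : Fin 1 => F.obj (P.obj m)) ⟶ F.obj (P.obj m) :=
      (ρ_ (F.obj (P.obj m))).hom
    have hr : laxTensorFin F (fun _ : Fin 1 => P.obj m) ≫ F.map r = r' :=
      (Category.assoc _ _ _).trans (right_unitality F (P.obj m)).symm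
    have hu : (P.unit ▷ tensorFin (fun _ : Fin 1 => P.obj m)) ≫ P.comp (fun _ : Fin 1 => m) h =
      (λ_ (tensorFin (fun _ : Fin 1 => P.obj m))).hom ≫ r := hP.unit_comp h
    change _ = (λ_ (tensorFin (fun _ : Fin 1 => F.obj (P.obj m)))).hom ≫ r'
    simp only [LambdaOperadData.map]
    rw [← whisker_exchange_assoc, comp_whiskerRight_assoc, μ_natural_left_assoc, ← F.map_comp, hu,
      F.map_comp, ← left_unitality_assoc, leftUnitor_naturality_assoc, hr]
  comp_unit {n} h := by
    have hu := hP.comp_unit h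
    simp only [LambdaOperadData.map]
    rw [← whiskerLeft_comp_assoc, tensorFinMap_comp, Category.assoc, laxTensorFin_natural,
      whiskerLeft_comp_assoc, whiskerLeft_comp_assoc, μ_natural_right_assoc, ← F.map_comp, hu,
      F.map_comp, ← μ_natural_right_assoc, right_unitality, ← whiskerLeft_comp_assoc,
      ← whiskerLeft_comp_assoc, Category.assoc, laxTensorFin_tensorUnits, whiskerLeft_comp_assoc]
  assoc {n} k s hk l m hl hl' := by
    have ha := hP.assoc k hk l hl hl'
    have hx := laxTensorFin_shuffle_flatten F (fun i => P.obj (k i)) k hk (fun p => P.obj (l p))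
    simp only [LambdaOperadData.map]
    -- Naturality moves the images of the inner compositions behind the constraints.
    have hL : tensorFinMap (fun i => (F.obj (P.obj (k i)) ◁
          laxTensorFin F (fun j => P.obj (l (blockIndex k hk i j)))) ≫ μ F _ _ ≫
            F.map (P.comp (fun j => l (blockIndex k hk i j)) rfl)) ≫ laxTensorFin F _ =
        tensorFinMap (fun i => (F.obj (P.obj (k i)) ◁
          laxTensorFin F (fun j => P.obj (l (blockIndex k hk i j)))) ≫ μ F _ _) ≫
        laxTensorFin F _ ≫
          F.map (tensorFinMap fun i => P.comp (fun j => l (blockIndex k hk i j)) rfl) := by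
      rw [← laxTensorFin_natural, ← tensorFinMap_comp_assoc]
      simp only [Category.assoc]
    rw [lax_whiskerLeft_comp F, ← whiskerLeft_comp_assoc, hL, ← Category.assoc (tensorFinMap _),
      whiskerLeft_comp_assoc, μ_natural_right_assoc, ← F.map_comp, ha, F.map_comp,
      ← μ_natural_right_assoc, ← whiskerLeft_comp_assoc, ← whiskerLeft_comp_assoc,
      Category.assoc (tensorFinMap _), hx, Category.assoc (tensorShuffle _ _)]
  act_one n := by
    simp only [LambdaOperadData.map, hP.act_one, F.map_id]
  act_mul g h := by
    simp only [LambdaOperadData.map, hP.act_mul, F.map_comp]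
  comp_act k m h g := by
    simp only [LambdaOperadData.map]
    rw [← whiskerLeft_comp_assoc, laxTensorFin_natural, whiskerLeft_comp_assoc,
      μ_natural_right_assoc, ← F.map_comp, hP.comp_act k h g, F.map_comp]
    simp only [Category.assoc]
  act_comp k m h g := by
    simp only [LambdaOperadData.map]
    rw [← whisker_exchange_assoc, μ_natural_left_assoc, ← F.map_comp, hP.act_comp k h g,
      F.map_comp, ← μ_natural_right_assoc, ← whiskerLeft_comp_assoc, laxTensorFin_tensorPerm,
      whiskerLeft_comp_assoc, F.map_comp]
    simp only [Category.assoc]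

variable (Λ) in
/-- The functor `P ↦ {F(P(n))}` induced on `Λ`-operads by a symmetric lax monoidal functor `F`. -/
def mapLambdaOperad (F : C ⥤ D) [F.LaxBraided] : LambdaOperad Λ C ⥤ LambdaOperad Λ D where
  obj P := ⟨P.data.map F, P.isLambdaOperad.map F⟩
  map {P Q} f :=
    { app := fun n => F.map (f.app n)
      unit_app := by
        simp only [LambdaOperadData.map]
        rw [Category.assoc, ← F.map_comp, f.unit_app]
      comp_app := fun {n} k m h => by
        simp only [LambdaOperadData.map]
        rw [MonoidalCategory.tensorHom_def, Category.assoc, Category.assoc, Category.assoc,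
          ← whiskerLeft_comp_assoc, laxTensorFin_natural, whiskerLeft_comp_assoc,
          ← whisker_exchange_assoc, μ_natural_right_assoc, μ_natural_left_assoc,
          ← F.map_comp, f.comp_app, ← F.map_comp, ← F.map_comp, MonoidalCategory.tensorHom_def,
          Category.assoc]
      act_app := fun g => by
        simp only [LambdaOperadData.map]
        rw [← F.map_comp, f.act_app, F.map_comp] }
  map_id P := LambdaOperadHom.ext (funext fun n => F.map_id (P.data.obj n))
  map_comp f g := LambdaOperadHom.ext (funext fun n => F.map_comp (f.app n) (g.app n))

end Map

/-! ### Canonical isomorphisms of iterated products of sets -/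

section Types

/-- The element of an iterated product of sets with given components. -/
def tensorFinMk : {n : ℕ} → {X : Fin n → Type w} → (∀ i, X i) → tensorFin X
  | 0, _, _ => PUnit.unit
  | _ + 1, _, x => (x 0, tensorFinMk (fun i => x i.succ))

theorem tensorFinComponents_mk : ∀ {n : ℕ} {X : Fin n → Type w} (x : ∀ i, X i),
    tensorFinComponents (tensorFinMk x) = x
  | 0, _, _ => funext fun i => i.elim0
  | _ + 1, _, x => funext fun i => by
      refine Fin.cases rfl (fun i => ?_) i
      exact congrFun (tensorFinComponents_mk fun i => x i.succ) i

theorem tensorFinMk_components : ∀ {n : ℕ} {X : Fin n → Type w} (p : tensorFin X),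
    tensorFinMk (tensorFinComponents p) = p
  | 0, _, _ => rfl
  | _ + 1, X, p => Prod.ext rfl (tensorFinMk_components (X := fun i => X i.succ) p.2)

theorem tensorFinMk_surjective {n : ℕ} {X : Fin n → Type w} :
    Function.Surjective (tensorFinMk (X := X)) :=
  fun p => ⟨_, tensorFinMk_components p⟩

theorem tensorFinMap_mk : ∀ {n : ℕ} {X Y : Fin n → Type w} (f : ∀ i, X i ⟶ Y i) (x : ∀ i, X i),
    tensorFinMap f (tensorFinMk x) = tensorFinMk (fun i => f i (x i))
  | 0, _, _, _, _ => rfl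
  | _ + 1, _, _, f, x =>
      Prod.ext rfl (tensorFinMap_mk (fun i => f i.succ) (fun i => x i.succ))

/-- An identification of two iterated products of members of one family `W` only reindexes elements.
Elements are taken of the form `x ∘ f` for a section `x` of `W`, so that no transport along
equalities of sets appears. -/
theorem tensorEq_mk {ι : Type*} {W : ι → Type w} (x : ∀ i, W i) {a b : ℕ} (h : a = b)
    (f : Fin a → ι) (g : Fin b → ι) (hfg : ∀ i, f i = g (Fin.cast h i))
    (hW : ∀ i, W (f i) = W (g (Fin.cast h i))) :
    tensorEq h (X := fun i => W (f i)) (Y := fun i => W (g i)) hW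
      (tensorFinMk fun i => x (f i)) = tensorFinMk fun i => x (g i) := by
  subst h
  obtain rfl : f = g := funext hfg
  rfl

theorem tensorAppend_mk : ∀ (a : ℕ) {b m : ℕ} (h : a + b = m) {W : Fin m → Type w}
    (x : ∀ i, W i),
    tensorAppend a h W (tensorFinMk (fun i : Fin a => x (Fin.cast h (Fin.castAdd b i))),
      tensorFinMk (fun j : Fin b => x (Fin.cast h (Fin.natAdd a j)))) = tensorFinMk x
  | 0, b, m, h, W, x =>
      tensorEq_mk x ((Nat.zero_add b).symm.trans h) (fun j => Fin.cast h (Fin.natAdd 0 j)) id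
        (fun j => Fin.ext (by simp)) _
  | a + 1, b, 0, h, _, _ => absurd h (by omega)
  | a + 1, b, m + 1, h, W, x => by
      have hE := tensorEq_mk x (rfl : b = b) (fun j => Fin.cast h (Fin.natAdd (a + 1) j))
        (fun j => (Fin.cast (by omega : a + b = m) (Fin.natAdd a j)).succ)
        (fun j => Fin.ext (Nat.succ_add_eq_add_succ a j))
        (fun j => congrArg W (Fin.ext (Nat.succ_add_eq_add_succ a j)))
      have ih := tensorAppend_mk a (by omega : a + b = m) (fun i => x i.succ)
      let A := tensorAppend a (by omega : a + b = m) (fun i => W i.succ)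
      exact Prod.ext rfl ((congrArg (fun t : tensorFin (fun j : Fin b =>
        W (Fin.cast (by omega : a + b = m) (Fin.natAdd a j)).succ) =>
          A (tensorFinMk (fun i : Fin a =>
            x (Fin.cast (by omega : a + b = m) (Fin.castAdd b i)).succ), t)) hE).trans ih)

theorem tensorFlatten_mk : ∀ {n : ℕ} (k : Fin n → ℕ) {s : ℕ} (hk : ∑ i, k i = s)
    {W : Fin s → Type w} (x : ∀ p, W p),
    tensorFlatten k hk W (tensorFinMk fun i => tensorFinMk fun j => x (blockIndex k hk i j)) =
      tensorFinMk x
  | 0, _, s, hk, W, x => by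
      obtain rfl : s = 0 := by simpa using hk.symm
      rfl
  | n + 1, k, s, hk, W, x => by
      have hk' : k 0 + ∑ i : Fin n, k i.succ = s := (Fin.sum_univ_succ k).symm.trans hk
      refine (congrArg (tensorAppend (k 0) hk' W) (Prod.ext ?_ ?_)).trans
        (tensorAppend_mk (k 0) hk' x)
      · exact tensorEq_mk x rfl _ _ (fun j => Fin.ext (by simp [blockIndex_val])) _
      · refine Eq.trans (congrArg (tensorFlatten (fun i : Fin n => k i.succ) rfl
          (fun p => W (Fin.cast hk' (Fin.natAdd (k 0) p)))) ?_)
          (tensorFlatten_mk (fun i : Fin n => k i.succ) rfl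
            (fun p => x (Fin.cast hk' (Fin.natAdd (k 0) p))))
        refine (tensorFinMap_mk _ _).trans (congrArg tensorFinMk (funext fun i => ?_))
        exact tensorEq_mk x rfl _ _ (fun j => Fin.ext (by
            simp [blockIndex_val, Fin.sum_univ_succ, Nat.add_assoc])) _

theorem tensorShuffle_mk : ∀ {n : ℕ} {X Y : Fin n → Type w} (x : ∀ i, X i) (y : ∀ i, Y i),
    tensorShuffle X Y (tensorFinMk fun i => (x i, y i)) = (tensorFinMk x, tensorFinMk y)
  | 0, _, _, _, _ => rfl
  | n + 1, X, Y, x, y =>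
      congrArg (fun t : tensorFin (fun i : Fin n => X i.succ) × tensorFin (fun i => Y i.succ) =>
        ((x 0, t.1), (y 0, t.2))) (tensorShuffle_mk (fun i => x i.succ) (fun i => y i.succ))

theorem tensorPull_mk : ∀ {n : ℕ} (p : Fin (n + 1)) {X : Fin (n + 1) → Type w} (x : ∀ i, X i),
    tensorPull p X (tensorFinMk x) = (x p, tensorFinMk fun i => x (p.succAbove i))
  | n, ⟨0, h0⟩, X, x => by
      rw [tensorPull]
      exact Prod.ext rfl (tensorEq_mk x rfl Fin.succ (⟨0, h0⟩ : Fin (n + 1)).succAbove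
        (fun _ => by simp) (fun _ => congrArg X (by simp)))
  | n + 1, ⟨q + 1, hq⟩, X, x => by
      have ih := tensorPull_mk ⟨q, Nat.lt_of_succ_lt_succ hq⟩ (fun i => x i.succ)
      let p : Fin (n + 1) := ⟨q, Nat.lt_of_succ_lt_succ hq⟩
      let e := (tensorEq (C := Type w) rfl (X := fun i : Fin n => X (p.succAbove i).succ)
        (Y := fun i => X (p.succ.succAbove i.succ))
        (fun i => congrArg X (Fin.succ_succAbove_succ p i).symm))
      have hE := tensorEq_mk x rfl (fun i => (p.succAbove i).succ)
        (fun i => p.succ.succAbove i.succ) (fun i => (Fin.succ_succAbove_succ p i).symm)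
        (fun i => congrArg X (Fin.succ_succAbove_succ p i).symm)
      exact (congrArg (fun t : X p.succ × tensorFin (fun i => X (p.succAbove i).succ) =>
        (t.1, (x 0, e t.2))) ih).trans (Prod.ext rfl (Prod.ext rfl hE))

theorem tensorPerm_mk : ∀ {n : ℕ} (τ : Equiv.Perm (Fin n)) {X : Fin n → Type w} (x : ∀ i, X i),
    tensorPerm τ X (tensorFinMk x) = tensorFinMk fun i => x (τ i)
  | 0, _, _, _ => rfl
  | n + 1, τ, X, x => by
      have hP := tensorPull_mk (τ 0) x
      have ih := tensorPerm_mk (permTail τ) fun i => x ((τ 0).succAbove i)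
      have hE := tensorEq_mk x rfl (fun i => (τ 0).succAbove (permTail τ i)) (fun i => τ i.succ)
        (fun i => succAbove_permTail τ i) (fun i => congrArg X (succAbove_permTail τ i))
      let e := tensorEq (C := Type w) rfl (X := fun i => X ((τ 0).succAbove (permTail τ i)))
        (Y := fun i => X (τ i.succ)) (fun i : Fin n => congrArg X (succAbove_permTail τ i))
      exact (congrArg (fun t : X (τ 0) × tensorFin (fun i => X ((τ 0).succAbove i)) =>
        (t.1, e (tensorPerm (permTail τ) (fun i => X ((τ 0).succAbove i)) t.2))) hP).trans
          (Prod.ext rfl ((congrArg e ih).trans hE))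

end Types

/-! ### The action operad and its translation categories -/

section Regular

/-- A translation category with a chosen object `x` is equivalent to the terminal category. -/
def translationEquivalence {X : Type w} (x : X) : Translation X ≌ Discrete PUnit.{1} where
  functor := (Functor.const _).obj ⟨⟨⟩⟩
  inverse := (Functor.const _).obj ⟨x⟩
  unitIso := NatIso.ofComponents (fun _ => ⟨⟨⟩, ⟨⟩, Subsingleton.elim _ _, Subsingleton.elim _ _⟩)
    (fun _ => Subsingleton.elim _ _)
  counitIso := NatIso.ofComponents (fun _ => eqToIso (Subsingleton.elim _ _))
    (fun _ => Subsingleton.elim _ _)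
  functor_unitIso_comp _ := Subsingleton.elim _ _

/-- Specialization of the interchange law to multiplication by `μ(e; g₁, …, gₙ)`. -/
theorem ActionOperad.comp_mul_one_comp (Λ : ActionOperad.{w}) {n : ℕ} (k : Fin n → ℕ) {m : ℕ}
    (h : ∑ i, k i = m) (x : Λ.obj n) (y g : ∀ i, Λ.obj (k i)) :
    Λ.comp k h x (fun i => y i * g i) = Λ.comp k h x y * Λ.comp k h 1 g := by
  have := Λ.comp_mul_comp k h x 1 y g
  rw [mul_one] at this
  rw [← this]
  congr 1
  -- `π e` is replaced by a variable `σ`, since the arities `k (σ⁻¹ i)` depend on it.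
  have aux : ∀ (σ : Equiv.Perm (Fin n)) (_ : σ = 1) (h' : ∑ i, k (σ.symm i) = m),
      Λ.comp (fun i => k (σ.symm i)) h' x (fun i => y (σ.symm i)) = Λ.comp k h x y := by
    rintro _ rfl _
    rfl
  exact aux _ (map_one (Λ.π n)) _

/-- Specialization of the interchange law to multiplication by `μ(g; e, …, e)`. -/
theorem ActionOperad.comp_mul (Λ : ActionOperad.{w}) {n : ℕ} (k : Fin n → ℕ) {m : ℕ}
    (h : ∑ i, k i = m) (x g : Λ.obj n) (y : ∀ i, Λ.obj (k i)) :
    Λ.comp k h (x * g) y =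
      Λ.comp (fun i => k ((Λ.π n g).symm i)) (sum_perm (Λ.π n g) k h) x
        (fun i => y ((Λ.π n g).symm i)) * Λ.comp k h g (fun _ => 1) := by
  rw [Λ.comp_mul_comp k h x g y]
  simp only [mul_one]

theorem type_hom_ext {X Y : Type w} {f g : X ⟶ Y} (h : ∀ x, f x = g x) : f = g :=
  ConcreteCategory.hom_ext _ _ h

theorem ActionOperad.regular_comp_mk (Λ : ActionOperad.{w}) {n : ℕ} (k : Fin n → ℕ) {m : ℕ}
    (h : ∑ i, k i = m) (x : Λ.obj n) (y : ∀ i, Λ.obj (k i)) :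
    Λ.regular.comp k h ((x, tensorFinMk y) : Λ.obj n × tensorFin fun i => Λ.obj (k i)) =
      Λ.comp k h x y :=
  congrArg (Λ.comp k h x) (tensorFinComponents_mk y)

/-- A family indexed by blocks and positions inside blocks comes from a family indexed by all
positions. -/
theorem exists_block_family {n : ℕ} (k : Fin n → ℕ) {s : ℕ} (hk : ∑ i, k i = s) {W : Fin s → Type w}
    (z : ∀ i j, W (blockIndex k hk i j)) : ∃ x : ∀ p, W p, ∀ i j, x (blockIndex k hk i j) = z i j :=
  ⟨Equiv.piCongrLeft W (finSigmaFinEquiv.trans (finCongr hk)) fun a => z a.1 a.2, fun i j =>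
    Equiv.piCongrLeft_apply_apply W (finSigmaFinEquiv.trans (finCongr hk))
      (fun a => z a.1 a.2) ⟨i, j⟩⟩

theorem ActionOperad.regular_isLambdaOperad (Λ : ActionOperad.{w}) :
    Λ.regular.IsLambdaOperad where
  unit_comp {m} h := type_hom_ext fun ⟨_, p⟩ => by
    obtain ⟨x, rfl⟩ := tensorFinMk_surjective p
    refine (Λ.regular_comp_mk _ h Λ.one x).trans ?_
    refine Eq.trans ?_ (Λ.one_comp h (x 0))
    congr 1
    funext i
    rw [Subsingleton.elim i 0]
  comp_unit {n} h := type_hom_ext fun ⟨x, p⟩ => by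
    obtain ⟨y, rfl⟩ := tensorFinMk_surjective p
    refine (congrArg (fun t => Λ.regular.comp (fun _ => 1) h
      ((x, t) : Λ.obj n × tensorFin fun _ : Fin n => Λ.obj 1)) (tensorFinMap_mk _ _)).trans ?_
    exact (Λ.regular_comp_mk _ h x _).trans (Λ.comp_one h x)
  assoc {n} k s hk l m hl hl' := type_hom_ext fun ⟨x, p⟩ => by
    obtain ⟨q, rfl⟩ := tensorFinMk_surjective p
    obtain ⟨z, hz⟩ := exists_block_family k hk (W := fun p => Λ.obj (l p))
      (fun i => tensorFinComponents (q i).2)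
    -- Every input is a family `y` together with a family `z` indexed by all `s` positions.
    have hq : q = fun i => ((q i).1, tensorFinMk fun j => z (blockIndex k hk i j)) := by
      funext i
      refine Prod.ext rfl ?_
      simp only [hz]
      exact (tensorFinMk_components _).symm
    rw [hq]
    let y : ∀ i, Λ.obj (k i) := fun i => (q i).1
    let Z : ∀ i, tensorFin (fun j => Λ.obj (l (blockIndex k hk i j))) :=
      fun i => tensorFinMk fun j => z (blockIndex k hk i j)
    have hL : tensorFinMap
        (fun i => Λ.regular.comp (fun j => l (blockIndex k hk i j)) rfl)
        (tensorFinMk fun i => (y i, Z i)) =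
        tensorFinMk fun i => Λ.comp (fun j => l (blockIndex k hk i j)) rfl (y i)
          (fun j => z (blockIndex k hk i j)) :=
      (tensorFinMap_mk _ _).trans
        (congrArg tensorFinMk (funext fun i => Λ.regular_comp_mk _ rfl (y i) _))
    have hR := tensorShuffle_mk y Z
    refine (congrArg (fun t => Λ.regular.comp (fun i => ∑ j, l (blockIndex k hk i j)) hl'
      ((x, t) : Λ.obj n × tensorFin fun i => Λ.obj (∑ j, l (blockIndex k hk i j)))) hL).trans ?_
    refine (Λ.regular_comp_mk _ hl' x _).trans ((Λ.assoc k hk l hl hl' x y z).trans ?_)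
    refine Eq.symm ((congrArg (fun t : tensorFin (fun i => Λ.obj (k i)) × tensorFin (fun i =>
        tensorFin fun j => Λ.obj (l (blockIndex k hk i j))) => Λ.regular.comp l hl
      ((Λ.regular.comp k hk ((x, t.1) : Λ.obj n × tensorFin fun i => Λ.obj (k i)),
        tensorFlatten k hk (fun p => Λ.obj (l p)) t.2) :
          Λ.obj s × tensorFin fun p => Λ.obj (l p))) hR).trans ?_)
    refine (congrArg₂ (fun a b => Λ.regular.comp l hl
      ((a, b) : Λ.obj s × tensorFin fun p => Λ.obj (l p))) (Λ.regular_comp_mk k hk x y)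
        (tensorFlatten_mk k hk z)).trans ?_
    exact Λ.regular_comp_mk l hl _ z
  act_one n := type_hom_ext fun (x : Λ.obj n) => mul_one x
  act_mul {n} g h := type_hom_ext fun (x : Λ.obj n) => (mul_assoc x g h).symm
  comp_act {n} k m h g := type_hom_ext fun ⟨x, p⟩ => by
    obtain ⟨y, rfl⟩ := tensorFinMk_surjective p
    refine (congrArg (fun t => Λ.regular.comp k h
      ((x, t) : Λ.obj n × tensorFin fun i => Λ.obj (k i))) (tensorFinMap_mk _ _)).trans ?_
    refine (Λ.regular_comp_mk _ h x _).trans ((Λ.comp_mul_one_comp k h x y g).trans ?_)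
    exact congrArg (· * Λ.comp k h 1 g) (Λ.regular_comp_mk k h x y).symm
  act_comp {n} k m h g := type_hom_ext fun ⟨(x : Λ.obj n), p⟩ => by
    obtain ⟨y, rfl⟩ := tensorFinMk_surjective p
    refine (Λ.regular_comp_mk k h (x * g) y).trans ((Λ.comp_mul k h x g y).trans ?_)
    refine congrArg (· * Λ.comp k h g fun _ => 1) ?_
    refine (Λ.regular_comp_mk _ (sum_perm (Λ.π n g) k h) x _).symm.trans ?_
    exact congrArg (fun t => Λ.regular.comp (fun i => k ((Λ.π n g).symm i))
      (sum_perm (Λ.π n g) k h)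
      ((x, t) : Λ.obj n × tensorFin fun i => Λ.obj (k ((Λ.π n g).symm i))))
      (tensorPerm_mk (Λ.π n g).symm y).symm

/-- `EΛ` is a `Λ`-operad in `Cat`, and it is `Λ_∞`. -/
theorem ActionOperad.exists_translationOperad (Λ : ActionOperad.{w}) :
    ∃ P : LambdaOperad Λ Cat.{w, w}, P.data = Λ.translationOperad ∧ P.IsLambdaInfinity := by
  refine ⟨⟨Λ.translationOperad, Λ.regular_isLambdaOperad.map translation⟩, rfl, ?_, ?_⟩
  · intro n g x hx
    let a : Λ.obj n := Translation.as x
    have h : a * g = a := congrArg Translation.as hx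
    exact mul_eq_left.mp h
  · intro n
    exact ⟨translationEquivalence (1 : Λ.obj n)⟩

end Regular

end LambdaOp

open LambdaOp
theorem mainTheorem10 (Λ : ActionOperad.{w}) :
    (∀ (M : Type u) [Category.{v} M] [MonoidalCategory M] [SymmetricCategory M] [HasColimits M]
        [∀ X : M, PreservesColimits (tensorLeft X)] [∀ X : M, PreservesColimits (tensorRight X)]
        (N : Type u') [Category.{v'} N] [MonoidalCategory N] [SymmetricCategory N] [HasColimits N]
        [∀ X : N, PreservesColimits (tensorLeft X)] [∀ X : N, PreservesColimits (tensorRight X)]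
        (F : M ⥤ N) [F.LaxBraided],
        ∃ Φ : LambdaOperad Λ M ⥤ LambdaOperad Λ N,
          (∀ P : LambdaOperad Λ M, (Φ.obj P).data = P.data.map F) ∧
          ∀ (P Q : LambdaOperad Λ M) (f : P ⟶ Q) (n : ℕ),
            HEq ((Φ.map f).app n) (F.map (f.app n))) ∧
    Λ.regular.IsLambdaOperad ∧
    ∃ P : LambdaOperad Λ Cat.{w, w}, P.data = Λ.translationOperad ∧ P.IsLambdaInfinity := by
  refine ⟨?_, Λ.regular_isLambdaOperad, Λ.exists_translationOperad⟩
  intro M _ _ _ _ _ _ N _ _ _ _ _ _ F _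
  exact ⟨mapLambdaOperad Λ F, fun _ => rfl, fun _ _ _ _ => HEq.rfl⟩
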